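/- Let $G$ be a cograph on $n$ vertices, that is, a finite graph that can be obtained from single-vertex graphs by repeatedly taking the disjoint union of two graphs or the complete join of two graphs (the disjoint union together with all edges between the two vertex sets). Let $k$ be an integer. For independent sets $I,J$ of $G$, say that $J$ is obtained from $I$ by one TAR-step if $J\neq I$ and there is a vertex $v$ with $I\cup\{v\}=J$ or $I=J\cup\{v\}$. Let $\mathrm{TAR}_k(G)$ be the graph whose vertices are the independent sets of $G$ of size at least $k$, two of them being adjacent if one is obtained from the other by one TAR-step. A $k$-TAR-sequence of length $p$ from $A$ to $B$ is a sequence $I_0,\ldots,I_p$ of independent sets of $G$, each of size at least $k$, with $I_0=A$ and $I_p=B$, such that for every $0\le i<p$ either $I_{i+1}=I_i$ or $I_{i+1}$ is obtained from $I_i$ by one TAR-step. Theorem. Let $A$ and $B$ be independent sets of $G$ of size at least $k$ such that $\mathrm{TAR}_k(G)$ contains a path from $A$ to $B$. Then there exists a $k$-TAR-sequence from $A$ to $B$ of length at most $4n-|A|-|B|$. -/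

import Mathlib

/-- Binary trees whose leaves carry a vertex and whose inner nodes are union nodes or join nodes,
with an ordered pair of children (left, right). -/
inductive Cotree (V : Type*) where
  | leaf (v : V) : Cotree V
  | union (l r : Cotree V) : Cotree V
  | join (l r : Cotree V) : Cotree V

namespace Cotree

/-- The vertex set of the graph associated with the root of the tree. -/
def verts {V : Type*} : Cotree V → Set V
  | leaf v => {v}
  | union l r => l.verts ∪ r.verts
  | join l r => l.verts ∪ r.verts

/-- Distinct leaves carry distinct vertices: at every inner node, the graphs of the two children
are vertex disjoint. -/
def WellFormed {V : Type*} : Cotree V → Prop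
  | leaf _ => True
  | union l r => l.WellFormed ∧ r.WellFormed ∧ Disjoint l.verts r.verts
  | join l r => l.WellFormed ∧ r.WellFormed ∧ Disjoint l.verts r.verts

/-- The edges of the graph associated with the root: a leaf gives a single vertex, a union node the
disjoint union of the graphs of its children, and a join node their complete join, which in
addition has all edges between the two vertex sets. (The graph lives on the ambient type `V`; its
vertex set is `verts`, and the vertices outside `verts` are isolated.) -/
def graph {V : Type*} : Cotree V → SimpleGraph V
  | leaf _ => ⊥
  | union l r => l.graph ⊔ r.graph
  | join l r => l.graph ⊔ r.graph ⊔ SimpleGraph.fromRel (fun x y => x ∈ l.verts ∧ y ∈ r.verts)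

/-- `T` is a cotree for `G`: the graph associated with the root of `T` is `G`. -/
def IsCotreeFor {V : Type*} (T : Cotree V) (G : SimpleGraph V) : Prop :=
  T.WellFormed ∧ T.verts = Set.univ ∧ T.graph = G

end Cotree

/-- A cograph is a graph for which there exists a cotree. -/
def IsCograph {V : Type*} (G : SimpleGraph V) : Prop :=
  ∃ T : Cotree V, T.IsCotreeFor G

/-- `J` is obtained from `I` using one TAR-step: adding one token or removing one token. -/
def TARStep {V : Type*} [DecidableEq V] (I J : Finset V) : Prop :=
  I ≠ J ∧ ∃ v : V, I ∪ {v} = J ∨ I = J ∪ {v}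

/-- The graph `TAR_k(G)`: its vertices are the independent sets of `G` of size at least `k`, and
two of them are adjacent if one is obtained from the other using one TAR-step. -/
def TARGraph {V : Type*} [DecidableEq V] (G : SimpleGraph V) (k : ℤ) :
    SimpleGraph {I : Finset V // G.IsIndepSet (I : Set V) ∧ k ≤ (I.card : ℤ)} where
  Adj I J := TARStep I.1 J.1
  symm := ⟨fun _ _ h => ⟨h.1.symm, h.2.imp fun _ hv => hv.symm.imp Eq.symm Eq.symm⟩⟩
  loopless := ⟨fun _ h => h.1 rfl⟩

/-- `A` and `B` are independent sets of size at least `k`, and `TAR_k(G)` contains a path from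
`A` to `B`. -/
def TARReachable {V : Type*} [DecidableEq V] (G : SimpleGraph V) (k : ℤ) (A B : Finset V) : Prop :=
  ∃ (hA : G.IsIndepSet (A : Set V) ∧ k ≤ (A.card : ℤ))
    (hB : G.IsIndepSet (B : Set V) ∧ k ≤ (B.card : ℤ)),
    (TARGraph G k).Reachable ⟨A, hA⟩ ⟨B, hB⟩

/-- `I 0, …, I p` is a `k`-TAR-sequence for `G` from `A` to `B`; its length is `p`.
The values of `I` after index `p` are irrelevant. -/
structure IsTARSequence {V : Type*} [DecidableEq V] (G : SimpleGraph V) (k : ℤ) (A B : Finset V)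
    (p : ℕ) (I : ℕ → Finset V) : Prop where
  start : I 0 = A
  finish : I p = B
  indep : ∀ i ≤ p, G.IsIndepSet (I i : Set V)
  card_ge : ∀ i ≤ p, k ≤ ((I i).card : ℤ)
  step : ∀ i < p, I (i + 1) = I i ∨ TARStep (I i) (I (i + 1))

namespace TokenReconfiguration

open Finset Relation

variable {V : Type*} [DecidableEq V]

/-- `F` is a nonempty downward closed family of finite subsets of `S`. -/
structure IsComplexOn (F : Finset V → Prop) (S : Set V) : Prop where
  empty : F ∅
  mono : ∀ {I J : Finset V}, F I → J ⊆ I → F J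
  supp : ∀ {I : Finset V}, F I → ∀ x ∈ I, x ∈ S

/-- `J` is a member of `F` obtained by adding one token to `I`, where `I` has at least `t` tokens. -/
def Up (F : Finset V → Prop) (t : ℕ) (I J : Finset V) : Prop :=
  ∃ v, v ∉ I ∧ J = insert v I ∧ F J ∧ t ≤ #I

/-- `I` and `J` are joined by a sequence of additions and removals within `F`, with never fewer
than `t` tokens. -/
def Conn (F : Finset V → Prop) (t : ℕ) : Finset V → Finset V → Prop :=
  ReflTransGen fun I J => Up F t I J ∨ Up F t J I

/-- A move on pairs consisting of the current set of tokens and the set of dead vertices: a token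
is placed on a vertex that is not dead, or a token is removed and its vertex becomes dead. -/
inductive Move (F : Finset V → Prop) (t : ℕ) :
    Finset V × Finset V → Finset V × Finset V → Prop
  | add {I D : Finset V} {v : V} (hI : v ∉ I) (hD : v ∉ D) (hF : F (insert v I)) (ht : t ≤ #I) :
      Move F t (I, D) (insert v I, D)
  | remove {I D : Finset V} {v : V} (hI : v ∉ I) (hF : F (insert v I)) (ht : t ≤ #I) :
      Move F t (insert v I, D) (I, insert v D)

/-- Reachability by moves. -/
def Reach (F : Finset V → Prop) (t : ℕ) :
    Finset V × Finset V → Finset V × Finset V → Prop :=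
  ReflTransGen (Move F t)

theorem Conn.symm {F : Finset V → Prop} {t : ℕ} {I J : Finset V} (h : Conn F t I J) :
    Conn F t J I :=
  by
  induction h with
  | refl => exact .refl
  | tail _ h ih => exact .head h.symm ih

theorem Conn.mono {F F' : Finset V → Prop} {t t' : ℕ} (hF : ∀ I, F I → F' I) (ht : t' ≤ t)
    {I J : Finset V} (h : Conn F t I J) : Conn F' t' I J := by
  refine ReflTransGen.mono ?_ _ _ h
  rintro I J (⟨v, h1, h2, h3, h4⟩ | ⟨v, h1, h2, h3, h4⟩)
  · exact Or.inl ⟨v, h1, h2, hF _ h3, ht.trans h4⟩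
  · exact Or.inr ⟨v, h1, h2, hF _ h3, ht.trans h4⟩

theorem Reach.mono {F F' : Finset V → Prop} {t t' : ℕ} (hF : ∀ I, F I → F' I) (ht : t' ≤ t)
    {p q : Finset V × Finset V} (h : Reach F t p q) : Reach F' t' p q := by
  refine ReflTransGen.mono ?_ _ _ h
  intro p q h
  cases h with
  | add hI hD hF' ht' => exact .add hI hD (hF _ hF') (ht.trans ht')
  | remove hI hF' ht' => exact .remove hI (hF _ hF') (ht.trans ht')

theorem Reach.conn {F : Finset V → Prop} {t : ℕ} {p q : Finset V × Finset V}
    (h : Reach F t p q) : Conn F t p.1 q.1 := by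
  induction h with
  | refl => exact .refl
  | tail _ h ih =>
    refine ih.tail ?_
    cases h with
    | add hI _ hF ht => exact Or.inl ⟨_, hI, rfl, hF, ht⟩
    | remove hI hF ht => exact Or.inr ⟨_, hI, rfl, hF, ht⟩

theorem Conn.le_card {F : Finset V → Prop} {t : ℕ} {I J : Finset V} (h : Conn F t I J)
    (hI : t ≤ #I) : t ≤ #J := by
  induction h with
  | refl => exact hI
  | tail _ h _ =>
    rcases h with ⟨v, h1, rfl, -, h4⟩ | ⟨v, h1, h2, -, h4⟩
    · exact h4.trans (card_le_card (subset_insert _ _))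
    · exact h4

theorem IsComplexOn.of_conn {F : Finset V → Prop} {S : Set V} (hF : IsComplexOn F S) {t : ℕ}
    {I J : Finset V} (h : Conn F t I J) (hI : F I) : F J := by
  induction h with
  | refl => exact hI
  | tail _ h ih =>
    rcases h with ⟨v, h1, rfl, h3, -⟩ | ⟨v, h1, h2, h3, -⟩
    · exact h3
    · exact hF.mono h3 (h2 ▸ subset_insert _ _)

theorem IsComplexOn.reach_supp {F : Finset V → Prop} {S : Set V} (hF : IsComplexOn F S) {t : ℕ}
    {p q : Finset V × Finset V} (h : Reach F t p q) (hp : ∀ x ∈ p.1 ∪ p.2, x ∈ S) :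
    ∀ x ∈ q.1 ∪ q.2, x ∈ S := by
  induction h with
  | refl => exact hp
  | tail _ h ih =>
    cases h with
    | add hI hD hF' _ =>
      intro x hx
      have := hF.supp hF' x
      have := ih x
      simp only [mem_union, mem_insert] at *
      tauto
    | remove hI hF' _ =>
      intro x hx
      have := ih x
      simp only [mem_union, mem_insert] at *
      tauto

theorem Reach.disjoint {F : Finset V → Prop} {t : ℕ} {p q : Finset V × Finset V}
    (h : Reach F t p q) (hp : Disjoint p.1 p.2) : Disjoint q.1 q.2 := by
  induction h with
  | refl => exact hp
  | tail _ h ih =>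
    cases h with
    | add hI hD hF' _ => simpa [hD] using ih
    | remove hI hF' _ =>
      simp only [disjoint_insert_left] at ih
      simpa [hI] using ih.2

theorem reach_clear {F : Finset V → Prop} {S : Set V} (hF : IsComplexOn F S)
    (I D : Finset V) (hI : F I) : Reach F 0 (I, D) (∅, I ∪ D) := by
  induction I using Finset.induction_on generalizing D with
  | empty => rw [empty_union]; exact .refl
  | insert v I hv ih =>
    have := ih (insert v D) (hF.mono hI (subset_insert _ _))
    rw [union_insert] at this
    rw [insert_union]
    exact .head (.remove hv hI (Nat.zero_le _)) this

theorem conn_empty {F : Finset V → Prop} {S : Set V} (hF : IsComplexOn F S)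
    {I : Finset V} (hI : F I) : Conn F 0 I ∅ :=
  (reach_clear hF I ∅ hI).conn

/-- The componentwise union of two states. -/
def merge (p q : Finset V × Finset V) : Finset V × Finset V := (p.1 ∪ q.1, p.2 ∪ q.2)

theorem merge_comm (p q : Finset V × Finset V) : merge p q = merge q p := by
  simp [merge, union_comm]

theorem Reach.merge_right {F F' : Finset V → Prop} {S : Set V} (hF : IsComplexOn F S) {t k : ℕ}
    {p q r : Finset V × Finset V} (h : Reach F t p q)
    (hr : ∀ x ∈ r.1 ∪ r.2, x ∉ S) (hF' : ∀ I, F I → F' (I ∪ r.1)) (hk : k ≤ t + #r.1) :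
    Reach F' k (merge p r) (merge q r) := by
  have key : ∀ {I : Finset V} {v : V}, v ∉ I → F (insert v I) → t ≤ #I →
      v ∉ I ∪ r.1 ∧ v ∉ r.2 ∧ F' (insert v (I ∪ r.1)) ∧ k ≤ #(I ∪ r.1) := by
    intro I v hv hI ht
    have hvS := hF.supp hI v (mem_insert_self _ _)
    have hr1 : v ∉ r.1 ∪ r.2 := fun h => hr v h hvS
    have hd : Disjoint I r.1 := by
      rw [disjoint_left]
      exact fun x hx hx' => hr x (mem_union_left _ hx') (hF.supp hI x (mem_insert_of_mem hx))
    rw [mem_union, not_or] at hr1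
    refine ⟨by simp [hv, hr1.1], hr1.2, ?_, ?_⟩
    · simpa using hF' _ hI
    · rw [card_union_of_disjoint hd]; omega
  induction h with
  | refl => exact .refl
  | tail _ h ih =>
    refine ih.tail ?_
    cases h with
    | add hI hD hF' ht =>
      obtain ⟨h1, h2, h3, h4⟩ := key hI hF' ht
      simp only [merge, insert_union]
      exact .add h1 (by simp [hD, h2]) h3 h4
    | remove hI hF' ht =>
      obtain ⟨h1, h2, h3, h4⟩ := key hI hF' ht
      simp only [merge, insert_union]
      exact .remove h1 h3 h4

/-- A system of states `s A t` for `t ≤ #A`, obtained from `(A, ∅)` by moves while the threshold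
decreases, such that the token set of `s A t` is a largest set in the component of `A` at
threshold `t`, and depends only on that component. -/
structure IsSchedule (F : Finset V → Prop) (s : Finset V → ℕ → Finset V × Finset V) : Prop where
  start : ∀ A, F A → Reach F #A (A, ∅) (s A #A)
  next : ∀ A, F A → ∀ t < #A, Reach F t (s A (t + 1)) (s A t)
  max : ∀ A, F A → ∀ t ≤ #A, ∀ D, Conn F t A D → #D ≤ #(s A t).1
  unique : ∀ A, F A → ∀ B, F B → ∀ t ≤ #A, t ≤ #B → Conn F t A B → (s A t).1 = (s B t).1

namespace IsSchedule

variable {F : Finset V → Prop} {S : Set V} {s : Finset V → ℕ → Finset V × Finset V}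

theorem reach_of_le (hs : IsSchedule F s) {A : Finset V} (hA : F A) {t t' : ℕ} (h : t ≤ t')
    (ht' : t' ≤ #A) : Reach F t (s A t') (s A t) := by
  induction h with
  | refl => exact .refl
  | step h ih =>
    have h' : t ≤ _ := h
    exact ((hs.next A hA _ ht').mono (fun _ h => h) h').trans (ih (Nat.le_of_succ_le ht'))

theorem reach (hs : IsSchedule F s) {A : Finset V} (hA : F A) {t : ℕ} (ht : t ≤ #A) :
    Reach F t (A, ∅) (s A t) :=
  ((hs.start A hA).mono (fun _ h => h) ht).trans (hs.reach_of_le hA ht le_rfl)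

theorem conn (hs : IsSchedule F s) {A : Finset V} (hA : F A) {t : ℕ} (ht : t ≤ #A) :
    Conn F t A (s A t).1 :=
  (hs.reach hA ht).conn

theorem antitone (hs : IsSchedule F s) {A : Finset V} (hA : F A) {t t' : ℕ} (h : t ≤ t')
    (ht' : t' ≤ #A) : #(s A t').1 ≤ #(s A t).1 :=
  hs.max A hA t (h.trans ht') _ ((hs.conn hA ht').mono (fun _ h => h) h)

theorem mem (hF : IsComplexOn F S) (hs : IsSchedule F s) {A : Finset V} (hA : F A) {t : ℕ}
    (ht : t ≤ #A) : F (s A t).1 :=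
  hF.of_conn (hs.conn hA ht) hA

theorem supp (hF : IsComplexOn F S) (hs : IsSchedule F s) {A : Finset V} (hA : F A) {t : ℕ}
    (ht : t ≤ #A) : ∀ x ∈ (s A t).1 ∪ (s A t).2, x ∈ S :=
  hF.reach_supp (hs.reach hA ht) (by simpa using hF.supp hA)

theorem card_le_zero (hF : IsComplexOn F S) (hs : IsSchedule F s) {A : Finset V} (hA : F A) :
    #A ≤ #(s ∅ 0).1 :=
  hs.max ∅ hF.empty 0 (Nat.zero_le _) A (conn_empty hF hA).symm

theorem zero_eq (hF : IsComplexOn F S) (hs : IsSchedule F s) {A : Finset V} (hA : F A) :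
    (s A 0).1 = (s ∅ 0).1 :=
  hs.unique A hA ∅ hF.empty 0 (Nat.zero_le _) (Nat.zero_le _) (conn_empty hF hA)

end IsSchedule

/-! ### A single vertex -/

omit [DecidableEq V] in
theorem isComplexOn_singleton (v : V) : IsComplexOn (fun I : Finset V => I ⊆ {v}) {v} where
  empty := by simp
  mono := fun h h' => h'.trans h
  supp := fun h x hx => by simpa using h hx

theorem isSchedule_singleton (v : V) :
    IsSchedule (fun I : Finset V => I ⊆ {v}) fun A t => if t = 0 then ({v}, ∅) else (A, ∅) where
  start := by
    intro A hA
    rcases subset_singleton_iff.1 hA with rfl | rfl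
    · exact .single (.add (by simp) (by simp) (by simp) (by simp))
    · simpa using .refl
  next := by
    intro A hA t ht
    rcases subset_singleton_iff.1 hA with rfl | rfl
    · simp at ht
    · obtain rfl : t = 0 := by simpa using ht
      simpa using .refl
  max := by
    intro A hA t ht D hD
    have hD' := card_le_card ((isComplexOn_singleton v).of_conn hD hA)
    rw [card_singleton] at hD'
    split_ifs with h
    · simpa using hD'
    · simp only
      omega
  unique := by
    intro A hA B hB t htA htB h
    split_ifs with h0
    · rfl
    · rcases subset_singleton_iff.1 hA with rfl | rfl
      · simp at htA; omega
      · rcases subset_singleton_iff.1 hB with rfl | rfl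
        · simp at htB; omega
        · rfl

/-! ### Disjoint unions of families, for joins of graphs -/

section Or

variable {F₁ F₂ : Finset V → Prop} {S₁ S₂ : Set V}

omit [DecidableEq V] in
theorem IsComplexOn.or (h₁ : IsComplexOn F₁ S₁) (h₂ : IsComplexOn F₂ S₂) :
    IsComplexOn (fun I => F₁ I ∨ F₂ I) (S₁ ∪ S₂) where
  empty := .inl h₁.empty
  mono := fun h hJ => h.imp (fun h => h₁.mono h hJ) (fun h => h₂.mono h hJ)
  supp := fun h x hx => h.imp (fun h => h₁.supp h x hx) (fun h => h₂.supp h x hx)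

theorem Conn.of_or_left (h₁ : IsComplexOn F₁ S₁) (h₂ : IsComplexOn F₂ S₂) (hd : Disjoint S₁ S₂)
    {t : ℕ} (ht : 0 < t) {A D : Finset V} (hA : F₁ A) (h : Conn (fun I => F₁ I ∨ F₂ I) t A D) :
    Conn F₁ t A D := by
  have key : ∀ {I : Finset V} {v : V}, F₂ (insert v I) → t ≤ #I → ¬ F₁ I := by
    intro I v hI hc h
    obtain ⟨x, hx⟩ := card_pos.1 (ht.trans_le hc)
    exact Set.disjoint_left.1 hd (h₁.supp h x hx) (h₂.supp hI x (mem_insert_of_mem hx))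
  induction h with
  | refl => exact .refl
  | tail _ h ih =>
    have hm := h₁.of_conn ih hA
    refine ih.tail ?_
    rcases h with ⟨v, hv, rfl, h3, h4⟩ | ⟨v, hv, rfl, h3, h4⟩
    · exact .inl ⟨v, hv, rfl, h3.resolve_right fun h => key h h4 hm, h4⟩
    · exact .inr ⟨v, hv, rfl, h3.resolve_right fun h =>
        key h h4 (h₁.mono hm (subset_insert _ _)), h4⟩

theorem exists_isSchedule_or_of_le (h₁ : IsComplexOn F₁ S₁) (h₂ : IsComplexOn F₂ S₂)
    (hd : Disjoint S₁ S₂) {s₁ s₂ : Finset V → ℕ → Finset V × Finset V} (hs₁ : IsSchedule F₁ s₁)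
    (hs₂ : IsSchedule F₂ s₂) (hle : #(s₂ ∅ 0).1 ≤ #(s₁ ∅ 0).1) :
    ∃ s, IsSchedule (fun I => F₁ I ∨ F₂ I) s := by
  classical
  have swap : ∀ {t : ℕ} {A D : Finset V}, 0 < t → F₂ A → Conn (fun I => F₁ I ∨ F₂ I) t A D →
      Conn F₂ t A D := fun ht hA h =>
    Conn.of_or_left h₂ h₁ hd.symm ht hA (h.mono (fun _ => Or.symm) le_rfl)
  have hl : ∀ I, F₁ I → F₁ I ∨ F₂ I := fun _ => .inl
  have hr : ∀ I, F₂ I → F₁ I ∨ F₂ I := fun _ => .inr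
  let s : Finset V → ℕ → Finset V × Finset V := fun A t =>
    if F₁ A then s₁ A t else if 0 < t then s₂ A t
      else merge (s₁ ∅ 0) (∅, (s₂ A 1).1 ∪ (s₂ A 1).2)
  have e1 : ∀ {A t}, F₁ A → s A t = s₁ A t := fun h => if_pos h
  have e2 : ∀ {A t}, ¬ F₁ A → 0 < t → s A t = s₂ A t := fun h h' => by simp only [s, if_neg h, if_pos h']
  have e3 : ∀ {A}, ¬ F₁ A → s A 0 = merge (s₁ ∅ 0) (∅, (s₂ A 1).1 ∪ (s₂ A 1).2) :=
    fun h => by simp [s, if_neg h]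
  have e0 : ∀ {A}, F₁ A ∨ F₂ A → (s A 0).1 = (s₁ ∅ 0).1 := by
    intro A _
    by_cases h : F₁ A
    · rw [e1 h, hs₁.zero_eq h₁ h]
    · rw [e3 h]; simp [merge]
  have hpos : ∀ {A}, ¬ F₁ A → 0 < #A := by
    intro A h
    rw [card_pos, nonempty_iff_ne_empty]
    rintro rfl
    exact h h₁.empty
  refine ⟨s, ?_, ?_, ?_, ?_⟩
  · intro A hA
    by_cases h : F₁ A
    · rw [e1 h]; exact (hs₁.start A h).mono hl le_rfl
    · rw [e2 h (hpos h)]; exact (hs₂.start A (hA.resolve_left h)).mono hr le_rfl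
  · intro A hA t ht
    by_cases h : F₁ A
    · rw [e1 h, e1 h]; exact (hs₁.next A h t ht).mono hl le_rfl
    · have hA2 := hA.resolve_left h
      rcases Nat.eq_zero_or_pos t with rfl | h0
      · rw [e2 h (Nat.succ_pos 0), e3 h]
        have hc := (reach_clear h₂ _ (s₂ A 1).2 (hs₂.mem h₂ hA2 (hpos h))).mono hr le_rfl
        refine ReflTransGen.trans hc ?_
        have := (hs₁.reach h₁.empty (Nat.zero_le _)).merge_right (F' := fun I => F₁ I ∨ F₂ I)
          (r := (∅, (s₂ A 1).1 ∪ (s₂ A 1).2)) (k := 0) h₁ ?_ ?_ (Nat.zero_le _)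
        · simp only [merge, empty_union, union_empty] at this ⊢
          exact this
        · intro x hx hx1
          simp only [empty_union] at hx
          exact Set.disjoint_left.1 hd hx1 (hs₂.supp h₂ hA2 (hpos h) x hx)
        · intro I hI
          simpa using Or.inl hI
      · rw [e2 h (Nat.succ_pos t), e2 h h0]; exact (hs₂.next A hA2 t ht).mono hr le_rfl
  · intro A hA t ht D hD
    rcases Nat.eq_zero_or_pos t with rfl | h0
    · rw [e0 hA]
      rcases (h₁.or h₂).of_conn hD hA with h | h
      · exact hs₁.card_le_zero h₁ h
      · exact (hs₂.card_le_zero h₂ h).trans hle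
    · by_cases h : F₁ A
      · rw [e1 h]; exact hs₁.max A h t ht D (hD.of_or_left h₁ h₂ hd h0 h)
      · rw [e2 h h0]
        exact hs₂.max A (hA.resolve_left h) t ht D (swap h0 (hA.resolve_left h) hD)
  · intro A hA B hB t htA htB hAB
    rcases Nat.eq_zero_or_pos t with rfl | h0
    · rw [e0 hA, e0 hB]
    · by_cases h : F₁ A
      · have hc := hAB.of_or_left h₁ h₂ hd h0 h
        have h' := h₁.of_conn hc h
        rw [e1 h, e1 h']; exact hs₁.unique A h B h' t htA htB hc
      · have h' : ¬ F₁ B := fun h' =>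
          h (h₁.of_conn (hAB.symm.of_or_left h₁ h₂ hd h0 h') h')
        rw [e2 h h0, e2 h' h0]
        exact hs₂.unique A (hA.resolve_left h) B (hB.resolve_left h') t htA htB
          (swap h0 (hA.resolve_left h) hAB)

theorem exists_isSchedule_or (h₁ : IsComplexOn F₁ S₁) (h₂ : IsComplexOn F₂ S₂)
    (hd : Disjoint S₁ S₂) {s₁ s₂ : Finset V → ℕ → Finset V × Finset V} (hs₁ : IsSchedule F₁ s₁)
    (hs₂ : IsSchedule F₂ s₂) : ∃ s, IsSchedule (fun I => F₁ I ∨ F₂ I) s := by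
  rcases le_total #(s₂ ∅ 0).1 #(s₁ ∅ 0).1 with h | h
  · exact exists_isSchedule_or_of_le h₁ h₂ hd hs₁ hs₂ h
  · obtain ⟨s, hs⟩ := exists_isSchedule_or_of_le h₂ h₁ hd.symm hs₂ hs₁ h
    simp only [or_comm] at hs
    exact ⟨s, hs⟩

end Or

/-! ### Products of families, for disjoint unions of graphs -/

/-- The unions of a member of `F₁` and a member of `F₂`. -/
def Prod (F₁ F₂ : Finset V → Prop) (I : Finset V) : Prop :=
  ∃ I₁ I₂, F₁ I₁ ∧ F₂ I₂ ∧ I = I₁ ∪ I₂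

theorem exists_descending_chain {α : Type*} (P : ℕ → α → Prop) (R : ℕ → α → α → Prop)
    (h : ∀ k x, P (k + 1) x → ∃ y, P k y ∧ R k x y) (n : ℕ) (x : α) (hx : P n x) :
    ∃ g : ℕ → α, g n = x ∧ (∀ k ≤ n, P k (g k)) ∧ ∀ k < n, R k (g (k + 1)) (g k) := by
  induction n generalizing x with
  | zero =>
    refine ⟨fun _ => x, rfl, ?_, by simp⟩
    intro k hk
    obtain rfl : k = 0 := by omega
    exact hx
  | succ n ih =>
    obtain ⟨y, hy, hxy⟩ := h n x hx
    obtain ⟨g, rfl, hg, hR⟩ := ih y hy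
    have e : ∀ k ≤ n, Function.update g (n + 1) x k = g k := fun k hk =>
      Function.update_of_ne (by omega) _ _
    refine ⟨Function.update g (n + 1) x, by simp, ?_, ?_⟩
    · intro k hk
      rcases Nat.le_succ_iff.1 hk with hk | rfl
      · rw [e k hk]; exact hg k hk
      · simpa using hx
    · intro k hk
      rcases Nat.lt_succ_iff_lt_or_eq.1 hk with hk | rfl
      · rw [e k (by omega), e (k + 1) (by omega)]; exact hR k hk
      · simpa [e k le_rfl] using hxy

theorem exists_fixpoint (k : ℕ) (f₁ f₂ : ℕ → ℕ) (Q : ℕ → ℕ → Prop)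
    (h₁ : ∀ a b, Q a b → Q (k - f₂ b) b) (h₂ : ∀ a b, Q a b → Q a (k - f₁ a))
    (hle : ∀ a b, Q a b → k - f₂ b ≤ a ∧ k - f₁ a ≤ b) (a b : ℕ) (hab : Q a b) :
    ∃ a' b', Q a' b' ∧ k - f₂ b' = a' ∧ k - f₁ a' = b' := by
  induction hn : a + b using Nat.strong_induction_on generalizing a b with
  | _ n ih =>
    by_cases ha : k - f₂ b = a
    · by_cases hb : k - f₁ a = b
      · exact ⟨a, b, hab, ha, hb⟩
      · have := (hle a b hab).2
        exact ih (a + (k - f₁ a)) (by omega) _ _ (h₂ a b hab) rfl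
    · have := (hle a b hab).1
      exact ih (k - f₂ b + b) (by omega) _ _ (h₁ a b hab) rfl

section Prod

variable {F₁ F₂ : Finset V → Prop} {S₁ S₂ : Set V}

theorem IsComplexOn.prod (h₁ : IsComplexOn F₁ S₁) (h₂ : IsComplexOn F₂ S₂) :
    IsComplexOn (Prod F₁ F₂) (S₁ ∪ S₂) where
  empty := ⟨∅, ∅, h₁.empty, h₂.empty, by simp⟩
  mono := by
    rintro _ J ⟨I₁, I₂, hI₁, hI₂, rfl⟩ hJ
    refine ⟨J ∩ I₁, J ∩ I₂, h₁.mono hI₁ inter_subset_right, h₂.mono hI₂ inter_subset_right, ?_⟩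
    rw [← inter_union_distrib_left, inter_eq_left.2 hJ]
  supp := by
    rintro _ ⟨I₁, I₂, hI₁, hI₂, rfl⟩ x hx
    exact (mem_union.1 hx).imp (h₁.supp hI₁ x) (h₂.supp hI₂ x)

omit [DecidableEq V] in
theorem IsComplexOn.disjoint (h₁ : IsComplexOn F₁ S₁) (h₂ : IsComplexOn F₂ S₂)
    (hd : Disjoint S₁ S₂) {I₁ I₂ : Finset V} (hI₁ : F₁ I₁) (hI₂ : F₂ I₂) : Disjoint I₁ I₂ :=
  disjoint_left.2 fun x hx hx' => Set.disjoint_left.1 hd (h₁.supp hI₁ x hx) (h₂.supp hI₂ x hx')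

theorem up_prod (h₁ : IsComplexOn F₁ S₁) (h₂ : IsComplexOn F₂ S₂)
    (hd : Disjoint S₁ S₂) {k : ℕ} {I J : Finset V} (h : Up (Prod F₁ F₂) k I J) :
    ∃ I₁ I₂ J₁ J₂, F₁ J₁ ∧ F₂ J₂ ∧ F₁ I₁ ∧ F₂ I₂ ∧ I = I₁ ∪ I₂ ∧ J = J₁ ∪ J₂ ∧ k ≤ #I₁ + #I₂ ∧
      ((Up F₁ #I₁ I₁ J₁ ∧ I₂ = J₂) ∨ (I₁ = J₁ ∧ Up F₂ #I₂ I₂ J₂)) := by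
  obtain ⟨v, hv, rfl, ⟨J₁, J₂, hJ₁, hJ₂, hJ⟩, hk⟩ := h
  have hdJ := h₁.disjoint h₂ hd hJ₁ hJ₂
  have hvJ : v ∈ J₁ ∪ J₂ := hJ ▸ mem_insert_self v I
  have hI : I = (J₁ ∪ J₂).erase v := by rw [← hJ, erase_insert hv]
  rcases mem_union.1 hvJ with h | h
  · have hI' : I = J₁.erase v ∪ J₂ := by
      rw [hI, erase_union_distrib, erase_eq_of_notMem (disjoint_left.1 hdJ h)]
    refine ⟨J₁.erase v, J₂, J₁, J₂, hJ₁, hJ₂, h₁.mono hJ₁ (erase_subset _ _), hJ₂, hI', hJ, ?_,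
      .inl ⟨⟨v, notMem_erase _ _, (insert_erase h).symm, hJ₁, le_rfl⟩, rfl⟩⟩
    exact hk.trans (hI' ▸ card_union_le _ _)
  · have hI' : I = J₁ ∪ J₂.erase v := by
      rw [hI, erase_union_distrib, erase_eq_of_notMem (disjoint_right.1 hdJ h)]
    refine ⟨J₁, J₂.erase v, J₁, J₂, hJ₁, hJ₂, hJ₁, h₂.mono hJ₂ (erase_subset _ _), hI', hJ, ?_,
      .inr ⟨rfl, ⟨v, notMem_erase _ _, (insert_erase h).symm, hJ₂, le_rfl⟩⟩⟩
    exact hk.trans (hI' ▸ card_union_le _ _)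

theorem union_injective (h₁ : IsComplexOn F₁ S₁) (h₂ : IsComplexOn F₂ S₂)
    (hd : Disjoint S₁ S₂) {I₁ I₂ J₁ J₂ : Finset V} (hI₁ : F₁ I₁) (hI₂ : F₂ I₂) (hJ₁ : F₁ J₁)
    (hJ₂ : F₂ J₂) (h : I₁ ∪ I₂ = J₁ ∪ J₂) : I₁ = J₁ ∧ I₂ = J₂ := by
  have a := h₁.disjoint h₂ hd hI₁ hI₂
  have b := h₁.disjoint h₂ hd hI₁ hJ₂
  have c := h₁.disjoint h₂ hd hJ₁ hI₂
  have d := h₁.disjoint h₂ hd hJ₁ hJ₂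
  rw [disjoint_left] at a b c d
  simp only [Finset.ext_iff, mem_union] at h ⊢
  constructor <;> intro x <;> have := h x <;> have := @a x <;> have := @b x <;>
    have := @c x <;> have := @d x <;> tauto

/-- If `C₁` and `C₂` are largest in their components at the thresholds that they leave to each
other, then the component of `C₁ ∪ C₂` projects into these components. -/
theorem conn_prod (h₁ : IsComplexOn F₁ S₁) (h₂ : IsComplexOn F₂ S₂)
    (hd : Disjoint S₁ S₂) {k : ℕ} {C₁ C₂ : Finset V} (hC₁ : F₁ C₁) (hC₂ : F₂ C₂)
    (hm₁ : ∀ D, Conn F₁ (k - #C₂) C₁ D → #D ≤ #C₁)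
    (hm₂ : ∀ D, Conn F₂ (k - #C₁) C₂ D → #D ≤ #C₂) {D : Finset V}
    (h : Conn (Prod F₁ F₂) k (C₁ ∪ C₂) D) :
    ∃ D₁ D₂, D = D₁ ∪ D₂ ∧ Conn F₁ (k - #C₂) C₁ D₁ ∧ Conn F₂ (k - #C₁) C₂ D₂ := by
  induction h with
  | refl => exact ⟨C₁, C₂, rfl, .refl, .refl⟩
  | tail _ h ih =>
    obtain ⟨D₁, D₂, hD, c₁, c₂⟩ := ih
    have m₁ := hm₁ _ c₁
    have m₂ := hm₂ _ c₂
    have f₁ := h₁.of_conn c₁ hC₁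
    have f₂ := h₂.of_conn c₂ hC₂
    have up_mono : ∀ {F : Finset V → Prop} {t t' : ℕ} {I J : Finset V}, Up F t I J → t' ≤ t →
        Up F t' I J := fun ⟨v, a, b, c, d⟩ h => ⟨v, a, b, c, h.trans d⟩
    rcases h with h | h <;> obtain ⟨I₁, I₂, J₁, J₂, j₁, j₂, i₁, i₂, rfl, rfl, hk, hu⟩ :=
      up_prod h₁ h₂ hd h
    · obtain ⟨rfl, rfl⟩ := union_injective h₁ h₂ hd i₁ i₂ f₁ f₂ hD
      rcases hu with ⟨hu, rfl⟩ | ⟨rfl, hu⟩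
      · exact ⟨J₁, _, rfl, c₁.tail (.inl (up_mono hu (by omega))), c₂⟩
      · exact ⟨_, J₂, rfl, c₁, c₂.tail (.inl (up_mono hu (by omega)))⟩
    · obtain ⟨rfl, rfl⟩ := union_injective h₁ h₂ hd j₁ j₂ f₁ f₂ hD
      rcases hu with ⟨hu, rfl⟩ | ⟨rfl, hu⟩
      · exact ⟨I₁, _, rfl, c₁.tail (.inr (up_mono hu (by omega))), c₂⟩
      · exact ⟨_, I₂, rfl, c₁, c₂.tail (.inr (up_mono hu (by omega)))⟩

theorem exists_chain_prod (h₁ : IsComplexOn F₁ S₁) (h₂ : IsComplexOn F₂ S₂)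
    (hd : Disjoint S₁ S₂) {s₁ s₂ : Finset V → ℕ → Finset V × Finset V} (hs₁ : IsSchedule F₁ s₁)
    (hs₂ : IsSchedule F₂ s₂) {A₁ A₂ : Finset V} (hA₁ : F₁ A₁) (hA₂ : F₂ A₂) :
    ∃ g : ℕ → ℕ × ℕ,
      Reach (Prod F₁ F₂) #(A₁ ∪ A₂) (A₁ ∪ A₂, ∅)
        (merge (s₁ A₁ (g #(A₁ ∪ A₂)).1) (s₂ A₂ (g #(A₁ ∪ A₂)).2)) ∧
      (∀ k ≤ #(A₁ ∪ A₂), (g k).1 ≤ #A₁ ∧ (g k).2 ≤ #A₂ ∧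
        k - #(s₂ A₂ (g k).2).1 = (g k).1 ∧ k - #(s₁ A₁ (g k).1).1 = (g k).2) ∧
      ∀ k < #(A₁ ∪ A₂), Reach (Prod F₁ F₂) k
        (merge (s₁ A₁ (g (k + 1)).1) (s₂ A₂ (g (k + 1)).2))
        (merge (s₁ A₁ (g k).1) (s₂ A₂ (g k).2)) := by
  have hcard : #(A₁ ∪ A₂) = #A₁ + #A₂ := card_union_of_disjoint (h₁.disjoint h₂ hd hA₁ hA₂)
  have move₁ : ∀ {k t : ℕ} {p q : Finset V × Finset V}, Reach F₁ t p q →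
      ∀ {b}, b ≤ #A₂ → k ≤ t + #(s₂ A₂ b).1 →
      Reach (Prod F₁ F₂) k (merge p (s₂ A₂ b)) (merge q (s₂ A₂ b)) := by
    intro k t p q h b hb hk
    refine h.merge_right h₁ (fun x hx hx1 => ?_) (fun I hI => ?_) hk
    · exact Set.disjoint_left.1 hd hx1 (hs₂.supp h₂ hA₂ hb x hx)
    · exact ⟨I, _, hI, hs₂.mem h₂ hA₂ hb, rfl⟩
  have move₂ : ∀ {k t : ℕ} {p q : Finset V × Finset V}, Reach F₂ t p q →
      ∀ {r : Finset V × Finset V}, F₁ r.1 → (∀ x ∈ r.1 ∪ r.2, x ∈ S₁) → k ≤ t + #r.1 →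
      Reach (Prod F₁ F₂) k (merge r p) (merge r q) := by
    intro k t p q h r hr1 hr hk
    rw [merge_comm r, merge_comm r]
    refine h.merge_right h₂ (fun x hx hx1 => ?_) (fun I hI => ?_) hk
    · exact Set.disjoint_left.1 hd (hr x hx) hx1
    · exact ⟨_, I, hr1, hI, union_comm _ _⟩
  have settle : ∀ (k : ℕ) (p : Finset V × Finset V) (a b : ℕ), a ≤ #A₁ → b ≤ #A₂ →
      k - #(s₂ A₂ b).1 ≤ a → k - #(s₁ A₁ a).1 ≤ b →
      Reach (Prod F₁ F₂) k p (merge (s₁ A₁ a) (s₂ A₂ b)) →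
      ∃ a' b', (a' ≤ #A₁ ∧ b' ≤ #A₂ ∧ k - #(s₂ A₂ b').1 ≤ a' ∧ k - #(s₁ A₁ a').1 ≤ b' ∧
        Reach (Prod F₁ F₂) k p (merge (s₁ A₁ a') (s₂ A₂ b'))) ∧
        k - #(s₂ A₂ b').1 = a' ∧ k - #(s₁ A₁ a').1 = b' := by
    intro k p a b ha hb h1 h2 hp
    refine exists_fixpoint k (fun a => #(s₁ A₁ a).1) (fun b => #(s₂ A₂ b).1)
      (fun a' b' => a' ≤ #A₁ ∧ b' ≤ #A₂ ∧ k - #(s₂ A₂ b').1 ≤ a' ∧ k - #(s₁ A₁ a').1 ≤ b' ∧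
        Reach (Prod F₁ F₂) k p (merge (s₁ A₁ a') (s₂ A₂ b'))) ?_ ?_ ?_ a b ⟨ha, hb, h1, h2, hp⟩
    · rintro a b ⟨ha, hb, h1, h2, hp⟩
      refine ⟨h1.trans ha, hb, le_rfl, ?_, hp.trans
        (move₁ (hs₁.reach_of_le hA₁ h1 ha) hb (by omega))⟩
      have := hs₁.antitone hA₁ h1 ha
      omega
    · rintro a b ⟨ha, hb, h1, h2, hp⟩
      refine ⟨ha, h2.trans hb, ?_, le_rfl, hp.trans
        (move₂ (hs₂.reach_of_le hA₂ h2 hb) (hs₁.mem h₁ hA₁ ha) (hs₁.supp h₁ hA₁ ha) (by omega))⟩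
      have := hs₂.antitone hA₂ h2 hb
      omega
    · rintro a b ⟨-, -, h1, h2, -⟩
      exact ⟨h1, h2⟩
  have l₁ := (hs₁.conn hA₁ le_rfl).le_card le_rfl
  have l₂ := (hs₂.conn hA₂ le_rfl).le_card le_rfl
  have hstart : Reach (Prod F₁ F₂) #(A₁ ∪ A₂) (A₁ ∪ A₂, ∅)
      (merge (s₁ A₁ #A₁) (s₂ A₂ #A₂)) := by
    have e : (A₁ ∪ A₂, ∅) = merge (A₁, ∅) (A₂, (∅ : Finset V)) := by simp [merge]
    rw [e]
    exact (move₂ (hs₂.start A₂ hA₂) hA₁ (by simpa using h₁.supp hA₁) (by simp only; omega)).trans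
      (move₁ (hs₁.start A₁ hA₁) le_rfl (by omega))
  obtain ⟨a, b, ⟨ha, hb, -, -, hR⟩, h1, h2⟩ :=
    settle _ _ _ _ le_rfl le_rfl (by omega) (by omega) hstart
  obtain ⟨g, hg, hP, hR'⟩ := exists_descending_chain
    (fun k (x : ℕ × ℕ) => x.1 ≤ #A₁ ∧ x.2 ≤ #A₂ ∧
      k - #(s₂ A₂ x.2).1 = x.1 ∧ k - #(s₁ A₁ x.1).1 = x.2)
    (fun k x y => Reach (Prod F₁ F₂) k (merge (s₁ A₁ x.1) (s₂ A₂ x.2))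
      (merge (s₁ A₁ y.1) (s₂ A₂ y.2)))
    (by
      rintro k ⟨a, b⟩ ⟨ha, hb, h1, h2⟩
      simp only at ha hb h1 h2
      obtain ⟨a', b', ⟨ha', hb', -, -, hR⟩, h1', h2'⟩ :=
        settle k _ a b ha hb (by omega) (by omega) .refl
      exact ⟨(a', b'), ⟨ha', hb', h1', h2'⟩, hR⟩)
    #(A₁ ∪ A₂) (a, b) ⟨ha, hb, h1, h2⟩
  exact ⟨g, by rw [hg]; exact hR, hP, hR'⟩

theorem exists_isSchedule_prod (h₁ : IsComplexOn F₁ S₁) (h₂ : IsComplexOn F₂ S₂)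
    (hd : Disjoint S₁ S₂) {s₁ s₂ : Finset V → ℕ → Finset V × Finset V} (hs₁ : IsSchedule F₁ s₁)
    (hs₂ : IsSchedule F₂ s₂) : ∃ s, IsSchedule (Prod F₁ F₂) s := by
  have hex : ∀ A, ∃ σ : ℕ → Finset V × Finset V, Prod F₁ F₂ A →
      Reach (Prod F₁ F₂) #A (A, ∅) (σ #A) ∧
      (∀ k < #A, Reach (Prod F₁ F₂) k (σ (k + 1)) (σ k)) ∧
      ∃ A₁ A₂, F₁ A₁ ∧ F₂ A₂ ∧ ∀ k ≤ #A, ∃ a b, a ≤ #A₁ ∧ b ≤ #A₂ ∧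
        k - #(s₂ A₂ b).1 = a ∧ k - #(s₁ A₁ a).1 = b ∧ (σ k).1 = (s₁ A₁ a).1 ∪ (s₂ A₂ b).1 := by
    intro A
    by_cases hA : Prod F₁ F₂ A
    · obtain ⟨A₁, A₂, hA₁, hA₂, rfl⟩ := hA
      obtain ⟨g, hg, hP, hR⟩ := exists_chain_prod h₁ h₂ hd hs₁ hs₂ hA₁ hA₂
      refine ⟨fun k => merge (s₁ A₁ (g k).1) (s₂ A₂ (g k).2), fun _ => ⟨hg, hR, A₁, A₂, hA₁, hA₂,
        fun k hk => ?_⟩⟩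
      obtain ⟨a, b, c, d⟩ := hP k hk
      exact ⟨_, _, a, b, c, d, rfl⟩
    · exact ⟨fun _ => (∅, ∅), fun h => absurd h hA⟩
  choose s hs using hex
  have start : ∀ A, Prod F₁ F₂ A → Reach (Prod F₁ F₂) #A (A, ∅) (s A #A) :=
    fun A hA => (hs A hA).1
  have next : ∀ A, Prod F₁ F₂ A → ∀ t < #A, Reach (Prod F₁ F₂) t (s A (t + 1)) (s A t) :=
    fun A hA => (hs A hA).2.1
  have conn : ∀ A, Prod F₁ F₂ A → ∀ t ≤ #A, Conn (Prod F₁ F₂) t A (s A t).1 := by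
    intro A hA t ht
    induction ht using Nat.decreasingInduction with
    | self => exact (start A hA).conn
    | of_succ t ht ih => exact (ih.mono (fun _ h => h) (Nat.le_succ t)).trans (next A hA t ht).conn
  have main : ∀ A, Prod F₁ F₂ A → ∀ t ≤ #A, ∃ A₁ A₂ a b, F₁ A₁ ∧ F₂ A₂ ∧ a ≤ #A₁ ∧ b ≤ #A₂ ∧
      t - #(s₂ A₂ b).1 = a ∧ t - #(s₁ A₁ a).1 = b ∧ (s A t).1 = (s₁ A₁ a).1 ∪ (s₂ A₂ b).1 ∧
      ∀ D, Conn (Prod F₁ F₂) t A D → ∃ D₁ D₂, D = D₁ ∪ D₂ ∧ F₁ D₁ ∧ F₂ D₂ ∧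
        Conn F₁ a A₁ D₁ ∧ Conn F₂ b A₂ D₂ ∧ #D₁ ≤ #(s₁ A₁ a).1 ∧ #D₂ ≤ #(s₂ A₂ b).1 := by
    intro A hA t ht
    obtain ⟨-, -, A₁, A₂, hA₁, hA₂, h⟩ := hs A hA
    obtain ⟨a, b, ha, hb, h1, h2, e⟩ := h t ht
    refine ⟨A₁, A₂, a, b, hA₁, hA₂, ha, hb, h1, h2, e, fun D hD => ?_⟩
    have c₁ := hs₁.conn hA₁ ha
    have c₂ := hs₂.conn hA₂ hb
    have hCD : Conn (Prod F₁ F₂) t ((s₁ A₁ a).1 ∪ (s₂ A₂ b).1) D :=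
      e ▸ (conn A hA t ht).symm.trans hD
    obtain ⟨D₁, D₂, rfl, d₁, d₂⟩ := conn_prod h₁ h₂ hd (hs₁.mem h₁ hA₁ ha) (hs₂.mem h₂ hA₂ hb)
      (fun D hD => hs₁.max A₁ hA₁ a ha D (c₁.trans (h1 ▸ hD)))
      (fun D hD => hs₂.max A₂ hA₂ b hb D (c₂.trans (h2 ▸ hD))) hCD
    rw [h1] at d₁
    rw [h2] at d₂
    have d₁' := c₁.trans d₁
    have d₂' := c₂.trans d₂
    exact ⟨D₁, D₂, rfl, h₁.of_conn d₁' hA₁, h₂.of_conn d₂' hA₂, d₁', d₂',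
      hs₁.max A₁ hA₁ a ha D₁ d₁', hs₂.max A₂ hA₂ b hb D₂ d₂'⟩
  refine ⟨s, start, next, ?_, ?_⟩
  · intro A hA t ht D hD
    obtain ⟨A₁, A₂, a, b, hA₁, hA₂, ha, hb, h1, h2, e, h⟩ := main A hA t ht
    obtain ⟨D₁, D₂, rfl, -, -, -, -, l₁, l₂⟩ := h D hD
    rw [e, card_union_of_disjoint (h₁.disjoint h₂ hd (hs₁.mem h₁ hA₁ ha) (hs₂.mem h₂ hA₂ hb))]
    exact (card_union_le _ _).trans (add_le_add l₁ l₂)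
  · intro A hA B hB t htA htB hAB
    obtain ⟨A₁, A₂, a, b, hA₁, hA₂, ha, hb, h1, h2, e, h⟩ := main A hA t htA
    obtain ⟨B₁, B₂, a', b', hB₁, hB₂, ha', hb', h1', h2', e', h'⟩ := main B hB t htB
    obtain ⟨D₁, D₂, hD, f₁, f₂, d₁, d₂, l₁, l₂⟩ := h _ (hAB.trans (conn B hB t htB))
    obtain ⟨E₁, E₂, hE, g₁, g₂, -, -, m₁, m₂⟩ := h' _ (hAB.symm.trans (conn A hA t htA))
    rw [e'] at hD
    rw [e] at hE
    obtain ⟨rfl, rfl⟩ := union_injective h₁ h₂ hd (hs₁.mem h₁ hB₁ ha') (hs₂.mem h₂ hB₂ hb')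
      f₁ f₂ hD
    obtain ⟨rfl, rfl⟩ := union_injective h₁ h₂ hd (hs₁.mem h₁ hA₁ ha) (hs₂.mem h₂ hA₂ hb)
      g₁ g₂ hE
    obtain rfl : a = a' := by omega
    obtain rfl : b = b' := by omega
    rw [e, e', hs₁.unique A₁ hA₁ B₁ hB₁ a ha ha' (d₁.trans (hs₁.conn hB₁ ha').symm),
      hs₂.unique A₂ hA₂ B₂ hB₂ b hb hb' (d₂.trans (hs₂.conn hB₂ hb').symm)]

end Prod

/-! ### Cographs -/

/-- The independent sets of the graph of a cotree, by recursion on the tree. -/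
def indepFamily : Cotree V → Finset V → Prop
  | .leaf v => fun I => I ⊆ {v}
  | .union l r => Prod (indepFamily l) (indepFamily r)
  | .join l r => fun I => indepFamily l I ∨ indepFamily r I

theorem isComplexOn_indepFamily (T : Cotree V) : IsComplexOn (indepFamily T) T.verts := by
  induction T with
  | leaf v => exact isComplexOn_singleton v
  | union l r hl hr => exact hl.prod hr
  | join l r hl hr => exact hl.or hr

theorem exists_isSchedule_indepFamily (T : Cotree V) (hT : T.WellFormed) :
    ∃ s, IsSchedule (indepFamily T) s := by
  induction T with
  | leaf v => exact ⟨_, isSchedule_singleton v⟩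
  | union l r hl hr =>
    obtain ⟨s₁, hs₁⟩ := hl hT.1
    obtain ⟨s₂, hs₂⟩ := hr hT.2.1
    exact exists_isSchedule_prod (isComplexOn_indepFamily l) (isComplexOn_indepFamily r)
      hT.2.2 hs₁ hs₂
  | join l r hl hr =>
    obtain ⟨s₁, hs₁⟩ := hl hT.1
    obtain ⟨s₂, hs₂⟩ := hr hT.2.1
    exact exists_isSchedule_or (isComplexOn_indepFamily l) (isComplexOn_indepFamily r)
      hT.2.2 hs₁ hs₂

omit [DecidableEq V] in
theorem mem_verts_of_adj (T : Cotree V) {x y : V} (h : T.graph.Adj x y) :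
    x ∈ T.verts ∧ y ∈ T.verts := by
  induction T generalizing x y with
  | leaf v => simp [Cotree.graph] at h
  | union l r hl hr =>
    simp only [Cotree.graph, SimpleGraph.sup_adj] at h
    rcases h with h | h
    · exact (hl h).imp .inl .inl
    · exact (hr h).imp .inr .inr
  | join l r hl hr =>
    simp only [Cotree.graph, SimpleGraph.sup_adj, SimpleGraph.fromRel_adj] at h
    rcases h with (h | h) | ⟨-, h | h⟩
    · exact (hl h).imp .inl .inl
    · exact (hr h).imp .inr .inr
    · exact h.imp .inl .inr
    · exact ⟨.inr h.2, .inl h.1⟩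

theorem indepFamily_iff (T : Cotree V) (hT : T.WellFormed) (I : Finset V) :
    indepFamily T I ↔ (I : Set V) ⊆ T.verts ∧ T.graph.IsIndepSet (I : Set V) := by
  classical
  induction T generalizing I with
  | leaf v =>
    simp only [indepFamily, Cotree.verts, Cotree.graph]
    rw [← coe_subset, coe_singleton]
    exact ⟨fun h => ⟨h, fun x _ y _ _ => by simp⟩, fun h => h.1⟩
  | union l r hl hr =>
    obtain ⟨wl, wr, hd⟩ := hT
    constructor
    · rintro ⟨I₁, I₂, h₁, h₂, rfl⟩
      rw [hl wl] at h₁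
      rw [hr wr] at h₂
      rw [coe_union]
      refine ⟨Set.union_subset_union h₁.1 h₂.1, ?_⟩
      intro x hx y hy hxy h
      rw [Cotree.graph, SimpleGraph.sup_adj] at h
      rcases h with h | h
      · have hv := mem_verts_of_adj l h
        exact h₁.2 (hx.resolve_right fun h => Set.disjoint_left.1 hd hv.1 (h₂.1 h))
          (hy.resolve_right fun h => Set.disjoint_left.1 hd hv.2 (h₂.1 h)) hxy h
      · have hv := mem_verts_of_adj r h
        exact h₂.2 (hx.resolve_left fun h => Set.disjoint_left.1 hd (h₁.1 h) hv.1)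
          (hy.resolve_left fun h => Set.disjoint_left.1 hd (h₁.1 h) hv.2) hxy h
    · rintro ⟨hI, hi⟩
      refine ⟨I.filter (· ∈ l.verts), I.filter (· ∈ r.verts), (hl wl _).2 ⟨?_, ?_⟩,
        (hr wr _).2 ⟨?_, ?_⟩, ?_⟩
      · intro x hx; exact (mem_filter.1 hx).2
      · intro x hx y hy hxy h
        exact hi (mem_filter.1 hx).1 (mem_filter.1 hy).1 hxy (.inl h)
      · intro x hx; exact (mem_filter.1 hx).2
      · intro x hx y hy hxy h
        exact hi (mem_filter.1 hx).1 (mem_filter.1 hy).1 hxy (.inr h)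
      · rw [← filter_or, eq_comm, filter_eq_self]
        exact fun x hx => hI hx
  | join l r hl hr =>
    obtain ⟨wl, wr, hd⟩ := hT
    simp only [indepFamily, hl wl, hr wr]
    constructor
    · rintro (⟨h, hi⟩ | ⟨h, hi⟩)
      · refine ⟨h.trans Set.subset_union_left, fun x hx y hy hxy ha => ?_⟩
        rw [Cotree.graph, SimpleGraph.sup_adj, SimpleGraph.sup_adj, SimpleGraph.fromRel_adj] at ha
        rcases ha with (ha | ha) | ⟨-, ha | ha⟩
        · exact hi hx hy hxy ha
        · exact Set.disjoint_left.1 hd (h hx) (mem_verts_of_adj r ha).1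
        · exact Set.disjoint_left.1 hd (h hy) ha.2
        · exact Set.disjoint_left.1 hd (h hx) ha.2
      · refine ⟨h.trans Set.subset_union_right, fun x hx y hy hxy ha => ?_⟩
        rw [Cotree.graph, SimpleGraph.sup_adj, SimpleGraph.sup_adj, SimpleGraph.fromRel_adj] at ha
        rcases ha with (ha | ha) | ⟨-, ha | ha⟩
        · exact Set.disjoint_left.1 hd (mem_verts_of_adj l ha).1 (h hx)
        · exact hi hx hy hxy ha
        · exact Set.disjoint_left.1 hd ha.1 (h hx)
        · exact Set.disjoint_left.1 hd ha.1 (h hy)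
    · rintro ⟨h, hi⟩
      have hil : l.graph.IsIndepSet (I : Set V) := fun x hx y hy hxy ha =>
        hi hx hy hxy (.inl (.inl ha))
      have hir : r.graph.IsIndepSet (I : Set V) := fun x hx y hy hxy ha =>
        hi hx hy hxy (.inl (.inr ha))
      by_cases hl' : (I : Set V) ⊆ l.verts
      · exact .inl ⟨hl', hil⟩
      · refine .inr ⟨fun y hy => (h hy).resolve_left fun hy' => ?_, hir⟩
        obtain ⟨x, hx, hxl⟩ := Set.not_subset.1 hl'
        have hxr := (h hx).resolve_left hxl
        have hxy : x ≠ y := fun e => hxl (e ▸ hy')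
        exact hi hx hy hxy (.inr ((SimpleGraph.fromRel_adj _ _ _).2 ⟨hxy, .inr ⟨hy', hxr⟩⟩))

/-! ### Token addition and removal sequences -/

theorem Up.tarStep {F : Finset V → Prop} {t : ℕ} {I J : Finset V} (h : Up F t I J) :
    TARStep I J := by
  obtain ⟨v, hv, rfl, -, -⟩ := h
  exact ⟨fun h => hv (h ▸ mem_insert_self v I), v, .inl (by rw [union_comm]; rfl)⟩

theorem conn_of_reachable {G : SimpleGraph V} {k : ℤ}
    {A B : {I : Finset V // G.IsIndepSet (I : Set V) ∧ k ≤ (I.card : ℤ)}}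
    (h : (TARGraph G k).Reachable A B) :
    Conn (fun I => G.IsIndepSet (I : Set V)) k.toNat A.1 B.1 := by
  have key : ∀ I J : {I : Finset V // G.IsIndepSet (I : Set V) ∧ k ≤ (I.card : ℤ)},
      I.1 ≠ J.1 → ∀ v, I.1 ∪ {v} = J.1 →
        Up (fun I => G.IsIndepSet (I : Set V)) k.toNat I.1 J.1 := by
    intro I J hne v hv
    have e : J.1 = insert v I.1 := by rw [← hv, union_comm]; rfl
    refine ⟨v, fun h => hne ?_, e, J.2.1, by have := I.2.2; omega⟩
    rw [e, insert_eq_of_mem h]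
  rw [SimpleGraph.reachable_iff_reflTransGen] at h
  induction h with
  | refl => exact .refl
  | tail _ h ih =>
    refine ih.tail ?_
    obtain ⟨hne, v, h | h⟩ := h
    · exact .inl (key _ _ hne v h)
    · exact .inr (key _ _ hne.symm v h.symm)

theorem Reach.exists_walk {G : SimpleGraph V} {k : ℤ} {p q : Finset V × Finset V}
    (h : Reach (fun I => G.IsIndepSet (I : Set V)) k.toNat p q)
    (hp : G.IsIndepSet (p.1 : Set V) ∧ k ≤ (#p.1 : ℤ)) :
    ∃ (hq : G.IsIndepSet (q.1 : Set V) ∧ k ≤ (#q.1 : ℤ))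
      (w : (TARGraph G k).Walk ⟨p.1, hp⟩ ⟨q.1, hq⟩),
      Disjoint p.1 p.2 → w.length + #p.1 + 2 * #p.2 = #q.1 + 2 * #q.2 := by
  induction h with
  | refl => exact ⟨hp, .nil, fun _ => by simp⟩
  | tail hpq h ih =>
    obtain ⟨hq, w, hw⟩ := ih
    cases h with
    | @add I D v hI hD hF ht =>
      have hr : G.IsIndepSet ((insert v I : Finset V) : Set V) ∧ k ≤ (#(insert v I) : ℤ) := by
        refine ⟨hF, ?_⟩
        rw [card_insert_of_notMem hI]
        push_cast
        omega
      have ha : (TARGraph G k).Adj ⟨I, hq⟩ ⟨insert v I, hr⟩ :=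
        Up.tarStep (F := fun _ => True) (t := 0) ⟨v, hI, rfl, trivial, Nat.zero_le _⟩
      refine ⟨hr, w.concat ha, fun hd => ?_⟩
      have := hw hd
      simp only [SimpleGraph.Walk.length_concat, card_insert_of_notMem hI] at *
      omega
    | @remove I D v hI hF ht =>
      have hr : G.IsIndepSet (I : Set V) ∧ k ≤ (#I : ℤ) :=
        ⟨fun x hx y hy => hF (mem_insert_of_mem hx) (mem_insert_of_mem hy), by omega⟩
      have ha : (TARGraph G k).Adj ⟨insert v I, hq⟩ ⟨I, hr⟩ :=
        SimpleGraph.Adj.symm (G := TARGraph G k) (u := ⟨I, hr⟩)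
          (Up.tarStep (F := fun _ => True) (t := 0) ⟨v, hI, rfl, trivial, Nat.zero_le _⟩)
      refine ⟨hr, w.concat ha, fun hd => ?_⟩
      have := hw hd
      have hvD : v ∉ D :=
        disjoint_left.1 (Reach.disjoint hpq hd) (mem_insert_self v I)
      simp only [SimpleGraph.Walk.length_concat, card_insert_of_notMem hI,
        card_insert_of_notMem hvD] at *
      omega

theorem isTARSequence_of_walk {G : SimpleGraph V} {k : ℤ}
    {A B : {I : Finset V // G.IsIndepSet (I : Set V) ∧ k ≤ (I.card : ℤ)}}
    (w : (TARGraph G k).Walk A B) :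
    IsTARSequence G k A.1 B.1 w.length fun i => (w.getVert i).1 where
  start := by simp
  finish := by simp
  indep i _ := (w.getVert i).2.1
  card_ge i _ := (w.getVert i).2.2
  step i hi := .inr (w.adj_getVert_succ hi)

end TokenReconfiguration

theorem mainTheorem6 {V : Type*} [Fintype V] [DecidableEq V] (G : SimpleGraph V)
    (hG : IsCograph G) (k : ℤ) (A B : Finset V) (hAB : TARReachable G k A B) :
    ∃ (p : ℕ) (I : ℕ → Finset V), IsTARSequence G k A B p I ∧
      (p : ℤ) ≤ 4 * (Fintype.card V : ℤ) - (A.card : ℤ) - (B.card : ℤ) := by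
  obtain ⟨T, hT, hv, rfl⟩ := hG
  obtain ⟨hA, hB, hr⟩ := hAB
  obtain ⟨s, hs⟩ := TokenReconfiguration.exists_isSchedule_indepFamily T hT
  have hfam : TokenReconfiguration.indepFamily T =
      fun I : Finset V => T.graph.IsIndepSet (I : Set V) := by
    funext I
    rw [TokenReconfiguration.indepFamily_iff T hT, hv]
    simp
  rw [hfam] at hs
  have hkA : k.toNat ≤ A.card := by omega
  have hkB : k.toNat ≤ B.card := by omega
  have hC := hs.unique A hA.1 B hB.1 k.toNat hkA hkB (TokenReconfiguration.conn_of_reachable hr)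
  have bound : ∀ X : Finset V, T.graph.IsIndepSet (X : Set V) → k.toNat ≤ X.card →
      (s X k.toNat).1.card + (s X k.toNat).2.card ≤ Fintype.card V := by
    intro X hX hk
    rw [← Finset.card_union_of_disjoint ((hs.reach hX hk).disjoint (by simp))]
    exact Finset.card_le_univ _
  have bA := bound A hA.1 hkA
  have bB := bound B hB.1 hkB
  obtain ⟨qA, wA, lA⟩ := (hs.reach hA.1 hkA).exists_walk hA
  obtain ⟨qB, wB, lB⟩ := (hs.reach hB.1 hkB).exists_walk hB
  have lA := lA (by simp)
  have lB := lB (by simp)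
  refine ⟨_, _, TokenReconfiguration.isTARSequence_of_walk
    (wA.append (wB.reverse.copy (Subtype.ext hC.symm) rfl)), ?_⟩
  simp only [SimpleGraph.Walk.length_append, SimpleGraph.Walk.length_copy,
    SimpleGraph.Walk.length_reverse, Finset.card_empty] at *
  push_cast
  omega
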